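/- Let $\mathfrak G=\mathbb Z[i]$ and let $f:\mathbb C\to\mathfrak G$ be any function such that $|z-f(z)|\le|z-\gamma|$ for all $z\in\mathbb C$ and $\gamma\in\mathfrak G$ (a nearest Gaussian integer map, with an arbitrary convention for breaking ties). For $z\in\mathbb C$ put $z_0=z$, $a_n=f(z_n)$ and $z_{n+1}=(z_n-a_n)^{-1}$, stopping at $n$ if $z_n=a_n$; the (finite or infinite) sequence $(a_n)_{n\ge0}$ is the Hurwitz expansion of $z$. It is infinite if $z\in\mathbb C'$, the set of complex numbers whose real or imaginary part is irrational. Let $S=\{x+iy : |x|<\tfrac12,\ |y|<\tfrac12\}$. A block $\beta=(b_1,\dots,b_l)$ with $l\ge1$, $b_j\in\mathfrak G$ and $|b_j|>1$ for all $j$, is called admissible if the set $S_\beta$ of all $z\in S$ whose Hurwitz expansion satisfies $(a_1,\dots,a_l)=\beta$ has nonempty interior. A number $z\in\mathbb C'$ is called generic if every admissible block occurs in its Hurwitz expansion, that is, for every admissible $\beta=(b_1,\dots,b_l)$ there is $k\ge0$ with $(a_k,\dots,a_{k+l-1})=\beta$. Proposition 8.5. The set of generic complex numbers contains a dense $G_\delta$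 subset of $\mathbb C$. -/

import Mathlib

namespace HurwitzCF

/-- A (single-valued) choice function of the Hurwitz algorithm: `f z` is a Gaussian integer at
minimum distance from `z`. Such an `f` amounts to a tie-breaking convention at the points having
several nearest Gaussian integers. -/
def IsHurwitzChoice (f : ℂ → GaussianInt) : Prop :=
  ∀ (z : ℂ) (γ : GaussianInt),
    ‖z - GaussianInt.toComplex (f z)‖ ≤ ‖z - GaussianInt.toComplex γ‖

/-- The iteration sequence `z₀ = z`, `zₙ₊₁ = (zₙ - f zₙ)⁻¹`. It is meaningful at index `n` only
if the algorithm has not stopped before, see `Reaches`. -/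
noncomputable def iter (f : ℂ → GaussianInt) (z : ℂ) : ℕ → ℂ
  | 0 => z
  | n + 1 => (iter f z n - GaussianInt.toComplex (f (iter f z n)))⁻¹

/-- The partial quotients `aₙ = f zₙ` of `z`. -/
noncomputable def expansion (f : ℂ → GaussianInt) (z : ℂ) (n : ℕ) : GaussianInt :=
  f (iter f z n)

/-- The algorithm started at `z` does not stop before index `n`, that is, `zₘ ≠ f zₘ` for all
`m < n`, so that `zₙ` and `aₙ` are defined. -/
def Reaches (f : ℂ → GaussianInt) (z : ℂ) (n : ℕ) : Prop :=
  ∀ m < n, GaussianInt.toComplex (f (iter f z m)) ≠ iter f z m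

/-- The set `ℂ'` of the complex numbers which are not rational, i.e. whose real or imaginary
part is irrational. On it the algorithm never stops. -/
def irrationalComplex : Set ℂ :=
  {z | Irrational z.re ∨ Irrational z.im}

/-- The open unit square `S` centred at the origin. -/
def openSquare : Set ℂ :=
  {z | |z.re| < 1 / 2 ∧ |z.im| < 1 / 2}

/-- The block `β = (b₁, …, b_l)` occurs in the sequence `a` starting at `k`. -/
def OccursAt (β : List GaussianInt) (a : ℕ → GaussianInt) (k : ℕ) : Prop :=
  ∀ (i : ℕ) (hi : i < β.length), a (k + i) = β[i]

/-- The set `S_β` of the `z ∈ S` whose Hurwitz expansion (possibly finite, but having at least the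
terms `a₀, …, a_l`) satisfies `(a₁, …, a_l) = β`. -/
def cylinder (f : ℂ → GaussianInt) (β : List GaussianInt) : Set ℂ :=
  {z | z ∈ openSquare ∧ Reaches f z β.length ∧ OccursAt β (expansion f z) 1}

/-- A block `β` (of length at least one, with entries of absolute value greater than `1`) is
admissible if `S_β` has nonempty interior. -/
def Admissible (f : ℂ → GaussianInt) (β : List GaussianInt) : Prop :=
  β ≠ [] ∧ (∀ b ∈ β, 1 < ‖GaussianInt.toComplex b‖) ∧ (interior (cylinder f β)).Nonempty

/-- A sequence is generic if every admissible block occurs in it. -/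
def IsGenericSeq (f : ℂ → GaussianInt) (a : ℕ → GaussianInt) : Prop :=
  ∀ β : List GaussianInt, Admissible f β → ∃ k : ℕ, OccursAt β a k

/-- The set of generic complex numbers: the `z ∈ ℂ'` whose Hurwitz expansion is generic. -/
def genericNumbers (f : ℂ → GaussianInt) : Set ℂ :=
  {z | z ∈ irrationalComplex ∧ IsGenericSeq f (expansion f z)}

end HurwitzCF

/-!
Near a Gaussian rational `a / c`, write `z = (a t + 1) / (c t)` with `t` large. As `t` tends to
infinity along a direction of irrational slope, each `zₙ` that is a Möbius function of `t` with a
pole tends to a Gaussian rational, and it leaves that limit in a direction parallel to neither axis.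
So the nearest Gaussian integer is eventually constant, even if the limit is a tie, and the
algorithm runs the Euclidean algorithm on `(a, c)`. After finitely many steps `zₙ = u t + v`
exactly, on a cone opening towards infinity. The image of this cone contains arbitrarily large
discs, hence a Gaussian translate of any cylinder with nonempty interior, and every admissible block
occurs on an open set arbitrarily close to `a / c`. Baire's theorem concludes.
-/

open AffineSpace Asymptotics Bornology Filter Set Topology

namespace HurwitzCF

section NearestGaussianInt

lemma norm_lt_one_of_abs_re_le_of_abs_im_le {z : ℂ} (hre : |z.re| ≤ 1 / 2)
    (him : |z.im| ≤ 1 / 2) : ‖z‖ < 1 := by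
  rw [← sq_lt_one_iff₀ (norm_nonneg z), Complex.sq_norm, Complex.normSq_apply]
  nlinarith [abs_le.1 hre, abs_le.1 him]

lemma exists_gaussianInt_norm_sub_lt_one (z : ℂ) : ∃ g : GaussianInt, ‖z - g‖ < 1 :=
  ⟨⟨round z.re, round z.im⟩, norm_lt_one_of_abs_re_le_of_abs_im_le
    (by simpa using abs_sub_round z.re) (by simpa using abs_sub_round z.im)⟩

lemma sq_lt_sub_intCast_sq {x : ℝ} (hx : |x| < 1 / 2) {m : ℤ} (hm : m ≠ 0) :
    x ^ 2 < (x - m) ^ 2 := by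
  have one_le : (1 : ℝ) ≤ |(m : ℝ)| := by exact_mod_cast Int.one_le_abs hm
  rw [sq_lt_sq]
  linarith [abs_sub_abs_le_abs_sub (m : ℝ) x, abs_sub_comm (m : ℝ) x]

lemma sq_le_sub_intCast_sq {x : ℝ} (hx : |x| < 1 / 2) (m : ℤ) : x ^ 2 ≤ (x - m) ^ 2 := by
  obtain rfl | hm := eq_or_ne m 0
  · simp
  · exact (sq_lt_sub_intCast_sq hx hm).le

lemma norm_lt_norm_sub_gaussianInt {z : ℂ} (hz : z ∈ openSquare) {g : GaussianInt}
    (hg : g ≠ 0) : ‖z‖ < ‖z - g‖ := by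
  rw [← sq_lt_sq₀ (norm_nonneg _) (norm_nonneg _), Complex.sq_norm, Complex.sq_norm,
    Complex.normSq_apply, Complex.normSq_apply]
  simp only [← sq, Complex.sub_re, Complex.sub_im, ← GaussianInt.intCast_re,
    ← GaussianInt.intCast_im]
  have hre := sq_le_sub_intCast_sq hz.1 g.re
  have him := sq_le_sub_intCast_sq hz.2 g.im
  by_cases h : g.re = 0
  · have := sq_lt_sub_intCast_sq hz.2 fun h' : g.im = 0 => hg (Zsqrtd.ext h h')
    linarith
  · have := sq_lt_sub_intCast_sq hz.1 h
    linarith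

lemma IsHurwitzChoice.eq_of_sub_mem_openSquare {f : ℂ → GaussianInt} (hf : IsHurwitzChoice f)
    {z : ℂ} {g : GaussianInt} (h : z - g ∈ openSquare) : f z = g := by
  by_contra hne
  have hlt := norm_lt_norm_sub_gaussianInt h (sub_ne_zero.2 hne)
  rw [map_sub, sub_sub_sub_cancel_right] at hlt
  exact (hf z g).not_gt hlt

end NearestGaussianInt

section OneSidedLimits

lemma exists_int_eventually_nhdsGT (x : ℝ) :
    ∃ k : ℤ, |x - k| ≤ 1 / 2 ∧ ∀ᶠ y : ℝ in 𝓝[>] x, |y - k| < 1 / 2 := by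
  refine ⟨round x, abs_sub_round x, ?_⟩
  have hround := (round_eq_iff (x := x)).1 rfl
  filter_upwards [Ioo_mem_nhdsGT hround.2] with y hy
  rw [abs_lt]
  constructor <;> linarith [hround.1, hy.1, hy.2]

lemma exists_int_eventually_nhdsLT (x : ℝ) :
    ∃ k : ℤ, |x - k| ≤ 1 / 2 ∧ ∀ᶠ y : ℝ in 𝓝[<] x, |y - k| < 1 / 2 := by
  obtain ⟨k, hk, hev⟩ := exists_int_eventually_nhdsGT (-x)
  have abs_eq (y : ℝ) : |y - (-k : ℤ)| = |-y - k| := by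
    rw [← abs_neg, Int.cast_neg]
    ring_nf
  refine ⟨-k, (abs_eq x).trans_le hk, ?_⟩
  filter_upwards [tendsto_neg_nhdsLT.eventually hev] with y hy
  rwa [abs_eq]

variable {α : Type*} {l : Filter α} {r : α → ℝ}

lemma exists_int_eventually_abs_sub_lt {φ : α → ℝ} {x y : ℝ} (hr : ∀ᶠ p in l, 0 < r p)
    (hφ : Tendsto φ l (𝓝 x)) (h : Tendsto (fun p => r p * (φ p - x)) l (𝓝 y)) (hy : y ≠ 0) :
    ∃ k : ℤ, |x - k| ≤ 1 / 2 ∧ ∀ᶠ p in l, |φ p - k| < 1 / 2 := by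
  rcases hy.lt_or_gt with hneg | hpos
  · have hlt : ∀ᶠ p in l, φ p < x := by
      filter_upwards [hr, h.eventually_lt_const hneg] with p hrp hp
      exact sub_neg.1 (neg_of_mul_neg_right hp hrp.le)
    obtain ⟨k, hk, hev⟩ := exists_int_eventually_nhdsLT x
    exact ⟨k, hk, (tendsto_nhdsWithin_iff.2 ⟨hφ, hlt⟩).eventually hev⟩
  · have hgt : ∀ᶠ p in l, x < φ p := by
      filter_upwards [hr, h.eventually_const_lt hpos] with p hrp hp
      exact sub_pos.1 ((mul_pos_iff_of_pos_left hrp).1 hp)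
    obtain ⟨k, hk, hev⟩ := exists_int_eventually_nhdsGT x
    exact ⟨k, hk, (tendsto_nhdsWithin_iff.2 ⟨hφ, hgt⟩).eventually hev⟩

lemma IsHurwitzChoice.exists_eventually_eq {f : ℂ → GaussianInt} (hf : IsHurwitzChoice f)
    {φ : α → ℂ} {x y : ℂ} (hr : ∀ᶠ p in l, 0 < r p) (hφ : Tendsto φ l (𝓝 x))
    (h : Tendsto (fun p => (r p : ℂ) * (φ p - x)) l (𝓝 y)) (hre : y.re ≠ 0) (him : y.im ≠ 0) :
    ∃ g : GaussianInt, ‖x - g‖ < 1 ∧ ∀ᶠ p in l, f (φ p) = g := by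
  have hre_lim := (Complex.continuous_re.tendsto y).comp h
  have him_lim := (Complex.continuous_im.tendsto y).comp h
  simp only [Function.comp_def, Complex.re_ofReal_mul, Complex.im_ofReal_mul, Complex.sub_re,
    Complex.sub_im] at hre_lim him_lim
  obtain ⟨k, hxk, hφk⟩ := exists_int_eventually_abs_sub_lt hr
    ((Complex.continuous_re.tendsto x).comp hφ) hre_lim hre
  obtain ⟨m, hxm, hφm⟩ := exists_int_eventually_abs_sub_lt hr
    ((Complex.continuous_im.tendsto x).comp hφ) him_lim him
  refine ⟨⟨k, m⟩, norm_lt_one_of_abs_re_le_of_abs_im_le (by simpa using hxk) (by simpa using hxm),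
    ?_⟩
  filter_upwards [hφk, hφm] with p hpk hpm
  exact hf.eq_of_sub_mem_openSquare ⟨by simpa using hpk, by simpa using hpm⟩

end OneSidedLimits

section Asymptotic

lemma tendsto_inv_norm_smul_asymptoticNhds {E : Type*} [NormedAddCommGroup E] [NormedSpace ℝ E]
    {ω : E} (hω : ω ≠ 0) :
    Tendsto (fun t => ‖t‖⁻¹ • t) (asymptoticNhds ℝ E ω) (𝓝 (‖ω‖⁻¹ • ω)) := by
  rw [asymptoticNhds_eq_smul, ← map₂_smul, ← map_prod_eq_map₂, tendsto_map'_iff]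
  have hlim : Tendsto (fun p : ℝ × E => ‖p.2‖⁻¹ • p.2) (atTop ×ˢ 𝓝 ω) (𝓝 (‖ω‖⁻¹ • ω)) :=
    (tendsto_snd.norm.inv₀ (norm_ne_zero_iff.2 hω)).smul tendsto_snd
  refine hlim.congr' ?_
  filter_upwards [tendsto_fst.eventually (eventually_gt_atTop 0)] with ⟨r, v⟩ (hr : 0 < r)
  simp only [Function.comp_apply, norm_smul, Real.norm_of_nonneg hr.le, mul_inv_rev, smul_smul]
  rw [mul_assoc, inv_mul_cancel₀ hr.ne', mul_one]

lemma tendsto_asymptoticNhds_of_sub_smul_isLittleO {E : Type*} [NormedAddCommGroup E]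
    [NormedSpace ℝ E] {ω : E} {φ : ℝ → E} (h : (fun r => φ r - r • ω) =o[atTop] (id : ℝ → ℝ)) :
    Tendsto φ atTop (asymptoticNhds ℝ E ω) := by
  have hlim : Tendsto (fun r : ℝ => ω + r⁻¹ • (φ r - r • ω)) atTop (𝓝 ω) := by
    simpa using h.tendsto_inv_smul_nhds_zero.const_add ω
  refine (tendsto_id.atTop_smul_nhds_tendsto_asymptoticNhds hlim).congr' ?_
  filter_upwards [eventually_ne_atTop 0] with r hr
  simp [smul_inv_smul₀ hr]

lemma frequently_asymptoticNhds_affine_sub_gaussianInt_mem {V : Set ℂ} (hV : V.Nonempty)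
    (ω : ℂ) {u : ℂ} (hu : u ≠ 0) (v : ℂ) :
    ∃ᶠ t in asymptoticNhds ℝ ℂ ω, ∃ g : GaussianInt, u * t + v - g ∈ V := by
  obtain ⟨s, hs⟩ := hV
  choose g hg using fun r : ℝ => exists_gaussianInt_norm_sub_lt_one (u * (r * ω) + v - s)
  let φ (r : ℝ) : ℂ := (g r + s - v) / u
  have hφ : Tendsto φ atTop (asymptoticNhds ℝ ℂ ω) := by
    have hbdd : (fun r => φ r - r • ω) =O[atTop] (fun _ => (1 : ℝ)) := by
      refine .of_bound ‖u⁻¹‖ (.of_forall fun r => ?_)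
      have hsub : φ r - r • ω = -(u⁻¹ * (u * (r * ω) + v - s - g r)) := by
        simp only [φ, Complex.real_smul]
        field_simp
        ring
      rw [hsub, norm_neg, norm_mul, norm_one]
      gcongr
      exact (hg r).le
    exact tendsto_asymptoticNhds_of_sub_smul_isLittleO
      (hbdd.trans_isLittleO (isLittleO_const_id_atTop 1))
  refine hφ.frequently (Eventually.of_forall fun r => ⟨g r, ?_⟩).frequently
  have : u * φ r + v - g r = s := by
    simp only [φ]
    field_simp
    ring
  rwa [this]

end Asymptotic

section IrrationalSlope

variable {ω : ℂ} {e c : GaussianInt}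

lemma ne_zero_of_irrational_slope (hω : Irrational (ω.im / ω.re)) : ω ≠ 0 := by
  rintro rfl
  simp at hω

lemma re_gaussianInt_mul_ne_zero (hω : Irrational (ω.im / ω.re)) (he : e ≠ 0) :
    ((e : ℂ) * ω).re ≠ 0 := by
  have hre : ω.re ≠ 0 := fun h => by simp [h] at hω
  rw [Complex.mul_re, ← GaussianInt.intCast_re, ← GaussianInt.intCast_im]
  intro h
  have hslope : (e.re : ℝ) = e.im * (ω.im / ω.re) := by
    field_simp
    linarith
  by_cases him : e.im = 0
  · rw [him, Int.cast_zero, zero_mul, Int.cast_eq_zero] at hslope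
    exact he (Zsqrtd.ext hslope him)
  · exact (hω.intCast_mul him).ne_int e.re hslope.symm

lemma re_gaussianInt_div_mul_ne_zero (hω : Irrational (ω.im / ω.re)) (he : e ≠ 0) (hc : c ≠ 0) :
    ((e : ℂ) / (c * ω)).re ≠ 0 := by
  have hcω : (c : ℂ) * ω ≠ 0 :=
    mul_ne_zero (GaussianInt.toComplex_eq_zero.not.2 hc) (ne_zero_of_irrational_slope hω)
  have hre_mul := re_gaussianInt_mul_ne_zero hω (mul_ne_zero (star_ne_zero.2 he) hc)
  have hre : ((e : ℂ) / (c * ω)).re =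
      (((star e * c : GaussianInt) : ℂ) * ω).re / Complex.normSq (c * ω) := by
    rw [Complex.div_re, ← add_div]
    simp only [Complex.mul_re, Complex.mul_im, map_mul, GaussianInt.toComplex_star, Complex.conj_re,
      Complex.conj_im, neg_mul, sub_neg_eq_add]
    ring
  rw [hre]
  exact div_ne_zero hre_mul (Complex.normSq_pos.2 hcω).ne'

lemma im_gaussianInt_div_mul_ne_zero (hω : Irrational (ω.im / ω.re)) (he : e ≠ 0) (hc : c ≠ 0) :
    ((e : ℂ) / (c * ω)).im ≠ 0 := by
  let i : GaussianInt := ⟨0, 1⟩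
  have hi : (i : ℂ) = Complex.I := by simp [i, GaussianInt.toComplex_def']
  have hi_ne : i ≠ 0 := by simp [← GaussianInt.toComplex_eq_zero, hi]
  have hre := re_gaussianInt_div_mul_ne_zero hω (mul_ne_zero hi_ne he) hc
  rwa [map_mul, hi, mul_div_assoc, Complex.I_mul_re, neg_ne_zero] at hre

end IrrationalSlope

section Moebius

/-- The Möbius transformation with coefficients `a`, `b`, `c`, `d`, the form of every `zₙ` as a
function of `t`. At a zero of the denominator its value is `0`. -/
noncomputable def moebius (a b c d t : ℂ) : ℂ := (a * t + b) / (c * t + d)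

variable {a b c d : ℂ}

lemma moebius_sub_inv {g t : ℂ} (ht : c * t + d ≠ 0) :
    (moebius a b c d t - g)⁻¹ = moebius c d (a - g * c) (b - g * d) t := by
  rw [moebius, div_sub' ht, inv_div, moebius]
  ring_nf

lemma eventually_cobounded_denom_ne_zero (hc : c ≠ 0) (d : ℂ) :
    ∀ᶠ t in cobounded ℂ, c * t + d ≠ 0 := by
  filter_upwards [eventually_ne_cobounded (-d / c)] with t ht h
  exact ht (by rw [eq_div_iff hc]; linear_combination h)

lemma map_moebius_nhds (hdet : a * d - b * c ≠ 0) {t : ℂ} (ht : c * t + d ≠ 0) :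
    map (moebius a b c d) (𝓝 t) = 𝓝 (moebius a b c d t) := by
  have hderiv : HasStrictDerivAt (moebius a b c d)
      ((a * (c * t + d) - (a * t + b) * c) / (c * t + d) ^ 2) t := by
    have hnum := ((hasStrictDerivAt_id t).const_mul a).add_const b
    have hden := ((hasStrictDerivAt_id t).const_mul c).add_const d
    simp only [mul_one] at hnum hden
    exact hnum.fun_div hden ht
  refine hderiv.map_nhds_eq (div_ne_zero ?_ (pow_ne_zero 2 ht))
  convert hdet using 1
  ring

lemma tendsto_mul_moebius_sub_cobounded (a b d : ℂ) (hc : c ≠ 0) :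
    Tendsto (fun t => t * (moebius a b c d t - a / c)) (cobounded ℂ)
      (𝓝 ((b * c - a * d) / (c * c))) := by
  have hden : Tendsto (fun t : ℂ => c * (c + d * t⁻¹)) (cobounded ℂ) (𝓝 (c * c)) := by
    simpa using ((tendsto_inv₀_cobounded.const_mul d).const_add c).const_mul c
  refine ((tendsto_const_nhds (x := b * c - a * d)).div hden (mul_ne_zero hc hc)).congr' ?_
  filter_upwards [eventually_ne_cobounded 0, eventually_cobounded_denom_ne_zero hc d]
    with t ht hct
  have hfac : c + d * t⁻¹ = (c * t + d) / t := by field_simp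
  rw [Pi.div_apply, hfac, moebius, div_sub_div _ _ hct hc]
  field_simp
  ring

lemma tendsto_moebius_cobounded (a b d : ℂ) (hc : c ≠ 0) :
    Tendsto (moebius a b c d) (cobounded ℂ) (𝓝 (a / c)) := by
  have hlim := (tendsto_inv₀_cobounded.mul
    (tendsto_mul_moebius_sub_cobounded a b d hc)).add_const (a / c)
  rw [zero_mul, zero_add] at hlim
  refine hlim.congr' ?_
  filter_upwards [eventually_ne_cobounded 0] with t ht
  rw [inv_mul_cancel_left₀ ht, sub_add_cancel]

lemma tendsto_norm_mul_moebius_sub_asymptoticNhds (a b d : ℂ) (hc : c ≠ 0) {ω : ℂ} (hω : ω ≠ 0) :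
    Tendsto (fun t : ℂ => (‖t‖ : ℂ) * (moebius a b c d t - a / c)) (asymptoticNhds ℝ ℂ ω)
      (𝓝 (‖ω‖ * ((b * c - a * d) / (c * c * ω)))) := by
  have hdir : Tendsto (fun t : ℂ => (‖t‖ : ℂ) / t) (asymptoticNhds ℝ ℂ ω) (𝓝 (‖ω‖ / ω)) := by
    have hne : ‖ω‖⁻¹ • ω ≠ 0 := smul_ne_zero (inv_ne_zero (norm_ne_zero_iff.2 hω)) hω
    have hlim := (tendsto_inv_norm_smul_asymptoticNhds hω).inv₀ hne
    simpa [div_eq_mul_inv, mul_comm] using hlim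
  have hprod := hdir.mul ((tendsto_mul_moebius_sub_cobounded a b d hc).mono_left
    (asymptoticNhds_le_cobounded hω))
  have hval : ‖ω‖ / ω * ((b * c - a * d) / (c * c)) =
      ‖ω‖ * ((b * c - a * d) / (c * c * ω)) := by
    field_simp
  rw [hval] at hprod
  refine hprod.congr' ?_
  filter_upwards [asymptoticNhds_le_cobounded hω (eventually_ne_cobounded 0)] with t ht
  rw [← mul_assoc, div_mul_cancel₀ _ ht]

end Moebius

section Expansion

variable {f : ℂ → GaussianInt}

lemma iter_add (f : ℂ → GaussianInt) (z : ℂ) (n k : ℕ) :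
    iter f z (n + k) = iter f (iter f z n) k := by
  induction k with
  | zero => rfl
  | succ k ih => rw [← add_assoc, iter, ih, iter]

lemma occursAt_of_iter_sub_mem_cylinder (hf : IsHurwitzChoice f) {β : List GaussianInt} {z : ℂ}
    {n : ℕ} {g : GaussianInt} (h : iter f z n - g ∈ cylinder f β) :
    OccursAt β (expansion f z) (n + 1) := by
  obtain ⟨hmem, -, hocc⟩ := h
  have hg : f (iter f z n) = g := hf.eq_of_sub_mem_openSquare hmem
  have hzero : f (iter f z n - g) = 0 := hf.eq_of_sub_mem_openSquare (by simpa using hmem)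
  have hiter : iter f (iter f z n - g) 1 = iter f z (n + 1) := by
    simp only [iter, hg, hzero, map_zero, sub_zero]
  intro i hi
  rw [← hocc i hi, expansion, expansion, iter_add, iter_add _ _ 1, hiter]

lemma exists_eventually_choice_moebius_eq (hf : IsHurwitzChoice f) {ω : ℂ}
    (hω : Irrational (ω.im / ω.re)) {a b c d : GaussianInt} (hdet : a * d - b * c ≠ 0)
    (hc : c ≠ 0) :
    ∃ g : GaussianInt, (a - g * c).norm.natAbs < c.norm.natAbs ∧
      ∀ᶠ t in asymptoticNhds ℝ ℂ ω, f (moebius a b c d t) = g := by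
  have hω₀ := ne_zero_of_irrational_slope hω
  have hcC : (c : ℂ) ≠ 0 := GaussianInt.toComplex_eq_zero.not.2 hc
  have hdet' : b * c - a * d ≠ 0 := by rwa [← neg_sub, neg_ne_zero]
  have hnorm : ‖ω‖ ≠ 0 := norm_ne_zero_iff.2 hω₀
  have hcobdd := asymptoticNhds_le_cobounded (P := ℂ) hω₀
  have hre := re_gaussianInt_div_mul_ne_zero hω hdet' (mul_ne_zero hc hc)
  have him := im_gaussianInt_div_mul_ne_zero hω hdet' (mul_ne_zero hc hc)
  simp only [map_sub, map_mul] at hre him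
  obtain ⟨g, hg, hev⟩ := hf.exists_eventually_eq
    ((eventually_ne_cobounded 0).filter_mono hcobdd |>.mono fun t ht => norm_pos_iff.2 ht)
    ((tendsto_moebius_cobounded a b d hcC).mono_left hcobdd)
    (tendsto_norm_mul_moebius_sub_asymptoticNhds a b d hcC hω₀)
    (by rw [Complex.re_ofReal_mul]; exact mul_ne_zero hnorm hre)
    (by rw [Complex.im_ofReal_mul]; exact mul_ne_zero hnorm him)
  refine ⟨g, ?_, hev⟩
  have hlt : ‖((a - g * c : GaussianInt) : ℂ)‖ < ‖(c : ℂ)‖ := by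
    have hfac : ((a - g * c : GaussianInt) : ℂ) = (a / c - g) * c := by
      rw [map_sub, map_mul]
      field_simp
    rw [hfac, norm_mul]
    exact mul_lt_of_lt_one_left (norm_pos_iff.2 hcC) hg
  rw [← sq_lt_sq₀ (norm_nonneg _) (norm_nonneg _), Complex.sq_norm, Complex.sq_norm,
    ← GaussianInt.intCast_real_norm, ← GaussianInt.intCast_real_norm, Int.cast_lt] at hlt
  exact Int.natAbs_lt_natAbs_of_nonneg_of_lt (GaussianInt.norm_nonneg _) hlt

lemma exists_eventually_iter_moebius_eq_affine (hf : IsHurwitzChoice f) {ω : ℂ}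
    (hω : Irrational (ω.im / ω.re)) {a b c d : GaussianInt} (hdet : a * d - b * c ≠ 0) :
    ∃ (n : ℕ) (u v : ℂ), u ≠ 0 ∧
      ∀ᶠ t in asymptoticNhds ℝ ℂ ω, iter f (moebius a b c d t) n = u * t + v := by
  induction hN : c.norm.natAbs using Nat.strong_induction_on generalizing a b c d with
  | _ N ih =>
  obtain rfl | hc := eq_or_ne c 0
  · rw [mul_zero, sub_zero] at hdet
    have ha : (a : ℂ) ≠ 0 := GaussianInt.toComplex_eq_zero.not.2 (left_ne_zero_of_mul hdet)
    have hd : (d : ℂ) ≠ 0 := GaussianInt.toComplex_eq_zero.not.2 (right_ne_zero_of_mul hdet)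
    refine ⟨0, a / d, b / d, div_ne_zero ha hd, .of_forall fun t => ?_⟩
    simp only [iter, moebius, map_zero, zero_mul, zero_add]
    ring
  · obtain ⟨g, hlt, hg⟩ := exists_eventually_choice_moebius_eq hf hω hdet hc
    have hdet' : c * (b - g * d) - d * (a - g * c) ≠ 0 := fun h =>
      hdet (by linear_combination -h)
    obtain ⟨n, u, v, hu, hn⟩ := ih _ (hN ▸ hlt) hdet' rfl
    refine ⟨1 + n, u, v, hu, ?_⟩
    have hcC : (c : ℂ) ≠ 0 := GaussianInt.toComplex_eq_zero.not.2 hc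
    filter_upwards [hg, hn, asymptoticNhds_le_cobounded (ne_zero_of_irrational_slope hω)
      (eventually_cobounded_denom_ne_zero hcC d)] with t hgt hnt hden
    rw [iter_add, ← hnt]
    simp only [iter, hgt, moebius_sub_inv hden, map_sub, map_mul]

end Expansion

section Residual

variable {f : ℂ → GaussianInt}

lemma dense_gaussianInt_div : Dense {z : ℂ | ∃ a c : GaussianInt, c ≠ 0 ∧ (a : ℂ) / c = z} := by
  refine Metric.dense_iff.2 fun z ε hε => ?_
  obtain ⟨n, hn⟩ := exists_nat_gt (1 / ε)
  have hn₀ : (0 : ℝ) < n := (by positivity : 0 < 1 / ε).trans hn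
  have hnC : (n : ℂ) ≠ 0 := by exact_mod_cast hn₀.ne'
  obtain ⟨g, hg⟩ := exists_gaussianInt_norm_sub_lt_one (n * z)
  refine ⟨(g : ℂ) / (n : GaussianInt), ?_, g, n, by exact_mod_cast hn₀.ne', rfl⟩
  have hsub : z - (g : ℂ) / n = (n * z - g) / n := by field_simp
  rw [mem_ball_iff_norm', map_natCast, hsub, norm_div, Complex.norm_natCast, div_lt_iff₀ hn₀]
  exact hg.trans ((div_lt_iff₀' hε).1 hn)

lemma exists_mem_eventually_occursAt (hf : IsHurwitzChoice f) {β : List GaussianInt}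
    (hβ : (interior (cylinder f β)).Nonempty) {U : Set ℂ} (hU : IsOpen U) (hne : U.Nonempty) :
    ∃ z ∈ U, ∃ k, ∀ᶠ w in 𝓝 z, OccursAt β (expansion f w) k := by
  let ω : ℂ := ⟨1, √2⟩
  have hω : Irrational (ω.im / ω.re) := by simpa [ω] using irrational_sqrt_two
  have hcobdd := asymptoticNhds_le_cobounded (P := ℂ) (ne_zero_of_irrational_slope hω)
  obtain ⟨_, hacU, a, c, hc, rfl⟩ := dense_gaussianInt_div.inter_open_nonempty U hU hne
  have hcC : (c : ℂ) ≠ 0 := GaussianInt.toComplex_eq_zero.not.2 hc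
  have hdet : a * 0 - 1 * c ≠ 0 := by simpa using hc
  obtain ⟨n, u, v, hu, hiter⟩ := exists_eventually_iter_moebius_eq_affine hf hω hdet
  simp only [map_one, map_zero] at hiter
  have hiter_nhds : ∀ᶠ t in asymptoticNhds ℝ ℂ ω, ∀ᶠ s in 𝓝 t,
      iter f (moebius a 1 c 0 s) n = u * s + v := by
    rwa [← asymptoticNhds_bind_nhds, eventually_bind] at hiter
  have hmem := ((tendsto_moebius_cobounded a 1 0 hcC).eventually_mem (hU.mem_nhds hacU)).filter_mono
    hcobdd
  have hden := (eventually_cobounded_denom_ne_zero hcC 0).filter_mono hcobdd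
  obtain ⟨t, ⟨g, hg⟩, hiter_t, hmem_t, hden_t⟩ :=
    ((frequently_asymptoticNhds_affine_sub_gaussianInt_mem hβ ω hu v).and_eventually
      (hiter_nhds.and (hmem.and hden))).exists
  refine ⟨_, hmem_t, n + 1, ?_⟩
  have hdetC : (a : ℂ) * 0 - 1 * c ≠ 0 := by simpa using hcC
  rw [← map_moebius_nhds hdetC hden_t, eventually_map]
  have hcont : ContinuousAt (fun s => u * s + v - g) t := by fun_prop
  filter_upwards [hiter_t, hcont.eventually_mem (mem_interior_iff_mem_nhds.1 hg)] with s hs hcyl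
  exact occursAt_of_iter_sub_mem_cylinder hf (hs ▸ hcyl)

lemma eventually_residual_occursAt (hf : IsHurwitzChoice f) {β : List GaussianInt}
    (hβ : (interior (cylinder f β)).Nonempty) :
    ∀ᶠ z in residual ℂ, ∃ k, OccursAt β (expansion f z) k := by
  have hdense : Dense (interior {z | ∃ k, OccursAt β (expansion f z) k}) := by
    refine dense_iff_inter_open.2 fun U hU hne => ?_
    obtain ⟨z, hzU, k, hk⟩ := exists_mem_eventually_occursAt hf hβ hU hne
    exact ⟨z, hzU, mem_interior_iff_mem_nhds.2 (hk.mono fun w hw => ⟨k, hw⟩)⟩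
  exact mem_of_superset (residual_of_dense_open isOpen_interior hdense) interior_subset

lemma irrationalComplex_mem_residual : irrationalComplex ∈ residual ℂ :=
  ((tendsto_residual_of_isOpenMap Complex.continuous_re Complex.isOpenMap_re).eventually
    eventually_residual_irrational).mono fun _ => Or.inl

instance : Countable GaussianInt :=
  Function.Injective.countable (f := fun g : GaussianInt => (g.re, g.im)) fun _ _ h =>
    Zsqrtd.ext (congrArg Prod.fst h) (congrArg Prod.snd h)

lemma genericNumbers_mem_residual (hf : IsHurwitzChoice f) : genericNumbers f ∈ residual ℂ := by
  have hgeneric : ∀ᶠ z in residual ℂ, IsGenericSeq f (expansion f z) :=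
    eventually_countable_forall.2 fun β => eventually_imp_distrib_left.2 fun hβ =>
      eventually_residual_occursAt hf hβ.2.2
  exact inter_mem irrationalComplex_mem_residual hgeneric

end Residual

end HurwitzCF

theorem proposition8p5 (f : ℂ → GaussianInt) (hf : HurwitzCF.IsHurwitzChoice f) :
    ∃ D : Set ℂ, IsGδ D ∧ Dense D ∧ D ⊆ HurwitzCF.genericNumbers f := by
  obtain ⟨D, hsub, hGδ, hdense⟩ := mem_residual.1 (HurwitzCF.genericNumbers_mem_residual hf)
  exact ⟨D, hGδ, hdense, hsub⟩
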